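/- A two-party XOR game with $m$ questions per party is given by a probability distribution $p$ on $[m]\times[m]$ and a function $f:[m]\times[m]\to\{0,1\}$: on questions $(x,y)$, drawn with probability $p(x,y)$, the players answer with bits $a,b$ and win iff $a\oplus b=f(x,y)$. Its game matrix is $\Phi=\big((-1)^{f(x,y)}p(x,y)\big)_{x,y\in[m]}$, and $\tilde\Phi=\big((-1)^{f(x,y)}\big)_{x,y\in[m]}$ is the non-normalized game matrix. Its exclusivity graph $G$ has the $2m^2$ vertices $(x,y,a)$, $x,y\in[m]$, $a\in\{0,1\}$, where $(x,y,a)$ represents the winning event in which the questions are $x,y$ and the answers are $a$ and $b=a\oplus f(x,y)$. Two vertices $(x,y,a)$ and $(x',y',a')$ are adjacent iff $$(x=x'\text{ and }a\neq a')\quad\text{or}\quad\big(y=y'\text{ and }(-1)^{a\oplus a'}\neq\tilde\Phi_{xy}\tilde\Phi_{x'y'}\big);$$ equivalently, iff one of the players receives the same question in both events but answers differently. For a finite graph $H$, $\alpha(H)$ denotes the independence number and $\Theta(H)=\sup_{n\ge 1}\alpha(H^{n})^{1/n}$ the Shannon capacity, where $H^{n}$ is the $n$-th strong power: its vertices are the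 words of length $n$ over the vertices of $H$, and two distinct words are adjacent iff in each position their letters are equal or adjacent in $H$. Let $\|\cdot\|$ be the spectral norm (the largest singular value). **Theorem.** Let $m\ge 1$ and consider a two-party XOR game with $m$ questions per party, chosen uniformly: $p(x,y)=1/m^2$ for all $x,y$. Suppose that the maximal singular value of $\Phi$ has a pair of (non-normalized) left and right singular vectors with entries $\pm1$, that is, there are $u,v\in\{1,-1\}^m$ with $\Phi v=\|\Phi\|\,u$ and $\Phi^{T}u=\|\Phi\|\,v$. Then $$\Theta(G)=\alpha(G)=\tfrac12\,m\,\big(m+\|\tilde\Phi\|\big).$$ -/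

import Mathlib

/-- The `n`-th strong power of a graph: its vertices are the words of length `n` over the vertices
of `G`, and two distinct words are adjacent iff in every position their letters are equal or
adjacent. -/
def SimpleGraph.strongPow {V : Type*} (G : SimpleGraph V) (n : ℕ) : SimpleGraph (Fin n → V) where
  Adj u v := u ≠ v ∧ ∀ i, u i = v i ∨ G.Adj (u i) (v i)
  symm := ⟨fun _ _ h => ⟨h.1.symm, fun i => (h.2 i).imp Eq.symm fun k => k.symm⟩⟩
  loopless := ⟨fun _ h => h.1 rfl⟩

/-- The Shannon capacity `sup_{n ≥ 1} α(Gⁿ)^(1/n)` of a finite graph, with `Gⁿ` the strong power. -/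
noncomputable def SimpleGraph.shannonCapacity {V : Type*} [Fintype V] (G : SimpleGraph V) : ℝ :=
  ⨆ n : ℕ+, ((G.strongPow n).indepNum : ℝ) ^ (1 / ((n : ℕ) : ℝ))

/-- The supremum that defines the Shannon capacity is over a bounded set. -/
theorem SimpleGraph.bddAbove_shannonCapacity {V : Type*} [Fintype V] (G : SimpleGraph V) :
    BddAbove (Set.range fun n : ℕ+ =>
      ((G.strongPow n).indepNum : ℝ) ^ (1 / ((n : ℕ) : ℝ))) := by
  classical
  refine ⟨Fintype.card V, ?_⟩
  rintro _ ⟨n, rfl⟩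
  obtain ⟨s, hs⟩ := (G.strongPow n).exists_isNIndepSet_indepNum
  have h1 : (G.strongPow n).indepNum ≤ Fintype.card V ^ (n : ℕ) := by
    rw [← hs.card_eq]
    simpa using s.card_le_univ
  have h2 : ((G.strongPow n).indepNum : ℝ) ≤ (Fintype.card V : ℝ) ^ (n : ℕ) := by
    exact_mod_cast h1
  calc ((G.strongPow n).indepNum : ℝ) ^ (1 / ((n : ℕ) : ℝ))
      ≤ ((Fintype.card V : ℝ) ^ (n : ℕ)) ^ (1 / ((n : ℕ) : ℝ)) :=
        Real.rpow_le_rpow (by positivity) h2 (by positivity)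
    _ = Fintype.card V := by
        rw [one_div]
        exact Real.pow_rpow_inv_natCast (by positivity) n.ne_zero

/-- The spectral norm of a real square matrix, that is, its operator norm for the Euclidean norm,
which is its largest singular value. -/
noncomputable def matrixSpectralNorm {m : ℕ} (M : Matrix (Fin m) (Fin m) ℝ) : ℝ :=
  ‖Matrix.toEuclideanCLM (n := Fin m) (𝕜 := ℝ) M‖

/-- `u` and `v` are a left and a right (non-normalized) singular vector that belong together and
belong to the largest singular value of `M`. -/
def IsMaxSingularPair {m : ℕ} (M : Matrix (Fin m) (Fin m) ℝ) (u v : Fin m → ℝ) : Prop :=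
  u ≠ 0 ∧ v ≠ 0 ∧
    M.mulVec v = matrixSpectralNorm M • u ∧ M.transpose.mulVec u = matrixSpectralNorm M • v

/-- A two-party XOR game in which each party has `m` possible questions. The referee draws the
questions `(x, y)` with probability `p x y`, the players answer with bits `a` and `b`, and they win
iff `a ⊕ b = f x y`. -/
structure XorGame (m : ℕ) where
  p : Fin m → Fin m → ℝ
  p_nonneg : ∀ x y, 0 ≤ p x y
  p_sum : ∑ x, ∑ y, p x y = 1
  f : Fin m → Fin m → Bool

namespace XorGame

/-- The questions are uniformly distributed. -/
def IsUniform {m : ℕ} (g : XorGame m) : Prop :=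
  ∀ x y, g.p x y = 1 / (m : ℝ) ^ 2

/-- The game matrix `Φ`, with entries `(-1)^{f(x,y)} p(x,y)`. -/
def gameMatrix {m : ℕ} (g : XorGame m) : Matrix (Fin m) (Fin m) ℝ :=
  Matrix.of fun x y => (-1) ^ (g.f x y).toNat * g.p x y

/-- The non-normalized game matrix `Φ̃`, with entries `(-1)^{f(x,y)}`. -/
def signMatrix {m : ℕ} (g : XorGame m) : Matrix (Fin m) (Fin m) ℝ :=
  Matrix.of fun x y => (-1) ^ (g.f x y).toNat

theorem signMatrix_mul_self {m : ℕ} (g : XorGame m) (x y : Fin m) :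
    g.signMatrix x y * g.signMatrix x y = 1 := by
  cases h : g.f x y <;> simp [signMatrix, h]

/-- The exclusivity graph of the game. The vertex `(x, y, a)` stands for the winning event
`(a, b | x, y)` with `b = a ⊕ f x y`. -/
def graph {m : ℕ} (g : XorGame m) : SimpleGraph (Fin m × Fin m × Bool) where
  Adj v w :=
    (v.1 = w.1 ∧ v.2.2 ≠ w.2.2) ∨
      (v.2.1 = w.2.1 ∧ (-1 : ℝ) ^ (xor v.2.2 w.2.2).toNat ≠
        g.signMatrix v.1 v.2.1 * g.signMatrix w.1 w.2.1)
  symm := ⟨by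
    rintro v w (⟨h1, h2⟩ | ⟨h1, h2⟩)
    · exact Or.inl ⟨h1.symm, h2.symm⟩
    · refine Or.inr ⟨h1.symm, ?_⟩
      rwa [Bool.xor_comm, mul_comm]⟩
  loopless := ⟨by
    rintro v (⟨_, h⟩ | ⟨_, h⟩)
    · exact h rfl
    · simp [signMatrix_mul_self] at h⟩

/-- Adjacency in terms of the events: the events are exclusive iff one of the players gets the same
question in both but answers differently. -/
theorem graph_adj_iff {m : ℕ} (g : XorGame m) (x y x' y' : Fin m) (a b a' b' : Bool)
    (h : xor a b = g.f x y) (h' : xor a' b' = g.f x' y') :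
    g.graph.Adj (x, y, a) (x', y', a') ↔ (x = x' ∧ a ≠ a') ∨ (y = y' ∧ b ≠ b') := by
  simp only [graph, signMatrix, Matrix.of_apply, ← h, ← h']
  cases a <;> cases b <;> cases a' <;> cases b' <;> norm_num

end XorGame

/-! Put `c = m(m + ‖Φ̃‖)/2`; the proof closes the chain `c ≤ α ≤ Θ ≤ c`. Upper bound: if `B`
vanishes on distinct non-adjacent pairs, has diagonal at most `c`, and `B - J ⪰ 0` for the all-ones
matrix `J`, then indicators of independent sets give `α ≤ c`. These conditions pass to tensor powers
with `c ^ n`, so `Θ ≤ c`. For the game, `thetaMatrix` serves as `B`: its part without answer signs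
dominates `J` by Cauchy–Schwarz, and its signed part is nonnegative by a spectral norm estimate
(`sum_row_sq_add_sum_col_sq_le`). Lower bound: the events won by the deterministic strategy `(u, v)`
are independent, and for a top singular pair of signs there are `c` of them. -/

/-! ### Semidefinite bounds on the Shannon capacity -/

open Matrix Kronecker in
/-- Kronecker powers of a matrix that dominates the all-ones matrix dominate the all-ones matrix. -/
theorem Matrix.PosSemidef.prod_sub_one {V : Type*} [Fintype V] {B : Matrix V V ℝ}
    (hB : (B - Matrix.of fun _ _ => 1).PosSemidef) (n : ℕ) :
    ((Matrix.of fun u w : Fin n → V => ∏ i, B (u i) (w i)) -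
      Matrix.of fun _ _ => 1).PosSemidef := by
  classical
  have hJ : ∀ (W : Type _) [Fintype W], (Matrix.of fun _ _ : W => (1 : ℝ)).PosSemidef := by
    intro W _
    have h := Matrix.posSemidef_vecMulVec_self_star (fun _ : W => (1 : ℝ))
    convert h using 1
    ext i j
    simp [Matrix.vecMulVec]
  induction n with
  | zero =>
    convert Matrix.PosSemidef.zero using 1
    ext u w
    simp
  | succ n ih =>
    have hT := ih.add (hJ (Fin n → V))
    rw [sub_add_cancel] at hT
    -- With `T` the `n`-th power: `B ⊗ T - J ⊗ J = (B - J) ⊗ T + J ⊗ (T - J)`, and `T = (T - J) + J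
    -- ⪰ 0`.
    have h := ((hB.kronecker hT).add ((hJ V).kronecker ih)).submatrix
      (fun u : Fin (n + 1) → V => (u 0, Fin.tail u))
    refine Eq.mpr (congrArg Matrix.PosSemidef ?_) h
    ext u w
    simp [Fin.prod_univ_succ, Fin.tail, Matrix.kroneckerMap_apply]
    ring

/-- A dual form of Lovász's bound for one graph. -/
theorem SimpleGraph.indepNum_le_of_posSemidef {V : Type*} [Fintype V] (G : SimpleGraph V)
    {B : Matrix V V ℝ} {c : ℝ} (hc : 0 ≤ c) (hB : (B - Matrix.of fun _ _ => 1).PosSemidef)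
    (hdiag : ∀ v, B v v ≤ c) (hzero : ∀ v w, v ≠ w → ¬ G.Adj v w → B v w = 0) :
    (G.indepNum : ℝ) ≤ c := by
  classical
  obtain ⟨s, hs⟩ := G.exists_isNIndepSet_indepNum
  rw [← hs.card_eq]
  -- On the indicator of `s` only the diagonal of `B` survives, so `|s|² ≤ ∑ B v v ≤ c |s|`.
  have h := hB.dotProduct_mulVec_nonneg (fun v => if v ∈ s then (1 : ℝ) else 0)
  have h1 : ∀ v ∈ s, ∑ w ∈ s, B v w = B v v := by
    intro v hv
    refine Finset.sum_eq_single_of_mem v hv fun w hw hne => hzero v w hne.symm ?_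
    exact hs.isIndepSet hv hw hne.symm
  have h2 : (0 : ℝ) ≤ ∑ v ∈ s, (B v v - s.card) := by
    refine h.trans_eq ?_
    simp only [dotProduct, Matrix.mulVec, Matrix.sub_apply, Matrix.of_apply, Pi.star_apply,
      star_trivial, ite_mul, one_mul, zero_mul, mul_ite, mul_one, mul_zero, Finset.sum_ite_mem,
      Finset.univ_inter]
    refine Finset.sum_congr rfl fun v hv => ?_
    rw [Finset.sum_sub_distrib, h1 v hv]
    simp
  have h3 : ∑ v ∈ s, (B v v - s.card) ≤ ∑ v ∈ s, (c - s.card) :=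
    Finset.sum_le_sum fun v _ => by linarith [hdiag v]
  rw [Finset.sum_const, nsmul_eq_mul] at h3
  rcases s.card.eq_zero_or_pos with h0 | h0
  · simpa [h0] using hc
  · have : (0 : ℝ) < s.card := by exact_mod_cast h0
    nlinarith

theorem SimpleGraph.indepNum_strongPow_le {V : Type*} [Fintype V] (G : SimpleGraph V)
    {B : Matrix V V ℝ} {c : ℝ} (hc : 0 ≤ c) (hB : (B - Matrix.of fun _ _ => 1).PosSemidef)
    (hdiag : ∀ v, B v v ≤ c) (hzero : ∀ v w, v ≠ w → ¬ G.Adj v w → B v w = 0) (n : ℕ) :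
    ((G.strongPow n).indepNum : ℝ) ≤ c ^ n := by
  refine (G.strongPow n).indepNum_le_of_posSemidef (by positivity) (hB.prod_sub_one n) ?_ ?_
  · intro u
    have hpos : ∀ v, 0 ≤ B v v := by
      intro v
      have := hB.diag_nonneg (i := v)
      simp only [Matrix.sub_apply, Matrix.of_apply] at this
      linarith
    calc ∏ i, B (u i) (u i) ≤ ∏ _i : Fin n, c :=
          Finset.prod_le_prod (fun i _ => hpos _) fun i _ => hdiag _
      _ = c ^ n := by simp
  · intro u w hne hadj
    have : ∃ i, ¬ (u i = w i ∨ G.Adj (u i) (w i)) := by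
      by_contra! h
      exact hadj ⟨hne, h⟩
    obtain ⟨i, hi⟩ := this
    rw [not_or] at hi
    exact Finset.prod_eq_zero (Finset.mem_univ i) (hzero _ _ hi.1 hi.2)

theorem SimpleGraph.indepNum_le_strongPow_one {V : Type*} [Fintype V] (G : SimpleGraph V) :
    G.indepNum ≤ (G.strongPow 1).indepNum := by
  classical
  obtain ⟨s, hs⟩ := G.exists_isNIndepSet_indepNum
  have hinj : Function.Injective (fun (v : V) (_ : Fin 1) => v) := fun v w h => congrFun h 0
  rw [← hs.card_eq, ← Finset.card_image_of_injective s hinj]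
  refine SimpleGraph.IsIndepSet.card_le_indepNum ?_
  intro u hu w hw hne hadj
  obtain ⟨v, hv, rfl⟩ := Finset.mem_image.1 (Finset.mem_coe.1 hu)
  obtain ⟨v', hv', rfl⟩ := Finset.mem_image.1 (Finset.mem_coe.1 hw)
  have hvv : v ≠ v' := fun h => hne (by rw [h])
  rcases hadj.2 0 with h | h
  · exact hvv h
  · exact hs.isIndepSet hv hv' hvv h

theorem SimpleGraph.indepNum_le_shannonCapacity {V : Type*} [Fintype V] (G : SimpleGraph V) :
    (G.indepNum : ℝ) ≤ G.shannonCapacity := by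
  refine le_trans ?_ (le_ciSup G.bddAbove_shannonCapacity 1)
  simpa using G.indepNum_le_strongPow_one

theorem SimpleGraph.shannonCapacity_le {V : Type*} [Fintype V] (G : SimpleGraph V)
    {B : Matrix V V ℝ} {c : ℝ} (hc : 0 ≤ c) (hB : (B - Matrix.of fun _ _ => 1).PosSemidef)
    (hdiag : ∀ v, B v v ≤ c) (hzero : ∀ v w, v ≠ w → ¬ G.Adj v w → B v w = 0) :
    G.shannonCapacity ≤ c := by
  refine ciSup_le fun n => ?_
  calc ((G.strongPow n).indepNum : ℝ) ^ (1 / ((n : ℕ) : ℝ))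
      ≤ (c ^ (n : ℕ)) ^ (1 / ((n : ℕ) : ℝ)) :=
        Real.rpow_le_rpow (by positivity) (G.indepNum_strongPow_le hc hB hdiag hzero n)
          (by positivity)
    _ = c := by
        rw [one_div]
        exact Real.pow_rpow_inv_natCast hc n.ne_zero

/-! ### Fibre sums and the spectral norm -/

/-- Summing over pairs in the same fibre gives a sum of squares of fibre sums. -/
theorem sum_sum_ite_fiber_eq {V ι : Type*} [Fintype V] [Fintype ι] [DecidableEq ι] (π : V → ι)
    (h : V → ℝ) :
    ∑ v, ∑ w, (if π v = π w then h v * h w else 0) =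
      ∑ i, (∑ v, if π v = i then h v else 0) ^ 2 := by
  simp_rw [sq, Finset.sum_mul_sum]
  symm
  rw [Finset.sum_comm]
  refine Finset.sum_congr rfl fun v _ => ?_
  rw [Finset.sum_comm]
  refine Finset.sum_congr rfl fun w _ => ?_
  simp [ite_mul, eq_comm]

theorem matrixSpectralNorm_nonneg {m : ℕ} (M : Matrix (Fin m) (Fin m) ℝ) :
    0 ≤ matrixSpectralNorm M := norm_nonneg _

theorem matrixSpectralNorm_smul {m : ℕ} (c : ℝ) (M : Matrix (Fin m) (Fin m) ℝ) :
    matrixSpectralNorm (c • M) = |c| * matrixSpectralNorm M := by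
  simp [matrixSpectralNorm, norm_smul]

/-- Cauchy–Schwarz and the operator norm bound, then `2‖R‖‖Q‖ ≤ ‖R‖² + ‖Q‖²`. -/
theorem two_mul_bilin_le_matrixSpectralNorm {m : ℕ} (M : Matrix (Fin m) (Fin m) ℝ)
    (r q : Fin m → ℝ) :
    2 * ∑ x, ∑ y, r x * M x y * q y ≤
      matrixSpectralNorm M * (∑ x, r x ^ 2 + ∑ y, q y ^ 2) := by
  set R : EuclideanSpace ℝ (Fin m) := WithLp.toLp 2 r
  set Q : EuclideanSpace ℝ (Fin m) := WithLp.toLp 2 q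
  have h1 : inner ℝ R (Matrix.toEuclideanCLM (n := Fin m) (𝕜 := ℝ) M Q) =
      ∑ x, ∑ y, r x * M x y * q y := by
    simp [PiLp.inner_apply, R, Q, Matrix.mulVec, dotProduct, Finset.sum_mul]
    refine Finset.sum_congr rfl fun x _ => Finset.sum_congr rfl fun y _ => by ring
  have h2 : ∑ x, r x ^ 2 = ‖R‖ ^ 2 := by simp [EuclideanSpace.norm_sq_eq, R]
  have h3 : ∑ x, q x ^ 2 = ‖Q‖ ^ 2 := by simp [EuclideanSpace.norm_sq_eq, Q]
  rw [← h1, h2, h3]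
  have h4 := real_inner_le_norm R (Matrix.toEuclideanCLM (n := Fin m) (𝕜 := ℝ) M Q)
  have h5 := (Matrix.toEuclideanCLM (n := Fin m) (𝕜 := ℝ) M).le_opNorm Q
  have h6 := mul_le_mul_of_nonneg_left h5 (norm_nonneg R)
  have h7 := mul_nonneg (matrixSpectralNorm_nonneg M) (sq_nonneg (‖R‖ - ‖Q‖))
  unfold matrixSpectralNorm at *
  nlinarith

/-! ### The dual matrix of the exclusivity graph -/

namespace XorGame

variable {m : ℕ} (g : XorGame m)

theorem signMatrix_sq (x y : Fin m) : g.signMatrix x y ^ 2 = 1 := by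
  rw [sq, signMatrix_mul_self]

theorem signMatrix_eq (x y : Fin m) : g.signMatrix x y = 1 ∨ g.signMatrix x y = -1 :=
  mul_self_eq_one_iff.1 (g.signMatrix_mul_self x y)

/-- The sum of the Gram matrices of the row sums and of the signed column sums is at most
`m + ‖Φ̃‖`. -/
theorem sum_row_sq_add_sum_col_sq_le (o : Fin m → Fin m → ℝ) :
    ∑ x, (∑ y, o x y) ^ 2 + ∑ y, (∑ x, g.signMatrix x y * o x y) ^ 2 ≤
      (m + matrixSpectralNorm g.signMatrix) * ∑ x, ∑ y, o x y ^ 2 := by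
  set σ := matrixSpectralNorm g.signMatrix
  have hσ : 0 ≤ σ := matrixSpectralNorm_nonneg _
  set r : Fin m → ℝ := fun x => ∑ y, o x y
  set q : Fin m → ℝ := fun y => ∑ x, g.signMatrix x y * o x y
  rcases Nat.eq_zero_or_pos m with rfl | hm
  · simp
  have hm' : (0 : ℝ) < m := by exact_mod_cast hm
  have h1 := two_mul_bilin_le_matrixSpectralNorm g.signMatrix r q
  -- The map `o ↦ (r, q)` composed with its adjoint is `m + [[0, Φ̃], [Φ̃ᵀ, 0]]`, with norm at most
  -- `m + σ`. Expanding this square and bounding the cross term by `h1` proves the estimate, up to a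
  -- factor `m + σ` that is positive once `m > 0`.
  have h2 : 0 ≤ ∑ x, ∑ y, ((m + σ) * o x y - r x - g.signMatrix x y * q y) ^ 2 :=
    Finset.sum_nonneg fun _ _ => Finset.sum_nonneg fun _ _ => sq_nonneg _
  have h3 : ∀ x y, ((m + σ) * o x y - r x - g.signMatrix x y * q y) ^ 2 =
      (m + σ) ^ 2 * o x y ^ 2 + r x ^ 2 + q y ^ 2 - 2 * (m + σ) * (r x * o x y)
        - 2 * (m + σ) * (q y * (g.signMatrix x y * o x y))
        + 2 * (r x * g.signMatrix x y * q y) := by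
    intro x y
    linear_combination (q y ^ 2) * g.signMatrix_sq x y
  have h4 : ∑ x, r x * ∑ y, o x y = ∑ x, r x ^ 2 :=
    Finset.sum_congr rfl fun x _ => by rw [sq]
  have h5 : ∑ x, ∑ y, q y * (g.signMatrix x y * o x y) = ∑ y, q y ^ 2 := by
    rw [Finset.sum_comm]
    exact Finset.sum_congr rfl fun y _ => by rw [← Finset.mul_sum, sq]
  simp only [h3, Finset.sum_add_distrib, Finset.sum_sub_distrib, ← Finset.mul_sum, h4, h5,
    Finset.sum_const, Finset.card_univ, Fintype.card_fin, nsmul_eq_mul] at h2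
  have h6 : 0 ≤ (m + σ) * ((m + σ) * ∑ x, ∑ y, o x y ^ 2 - (∑ x, r x ^ 2 + ∑ y, q y ^ 2)) := by
    nlinarith
  have h7 := nonneg_of_mul_nonneg_right h6 (by positivity)
  linarith

/-- Alice's answer in the event `v`, as a sign. -/
def aliceSign (v : Fin m × Fin m × Bool) : ℝ := (-1) ^ v.2.2.toNat

/-- Bob's answer in the event `v`, as a sign. -/
def bobSign (v : Fin m × Fin m × Bool) : ℝ := g.signMatrix v.1 v.2.1 * aliceSign v

theorem aliceSign_sq (v : Fin m × Fin m × Bool) : aliceSign v * aliceSign v = 1 := by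
  obtain ⟨x, y, a⟩ := v
  cases a <;> simp [aliceSign]

theorem bobSign_sq (v : Fin m × Fin m × Bool) : g.bobSign v * g.bobSign v = 1 := by
  unfold bobSign
  linear_combination g.signMatrix_sq v.1 v.2.1 + g.signMatrix v.1 v.2.1 ^ 2 * aliceSign_sq v

theorem aliceSign_eq_iff (v w : Fin m × Fin m × Bool) :
    aliceSign v * aliceSign w = 1 ↔ v.2.2 = w.2.2 := by
  obtain ⟨x, y, a⟩ := v
  obtain ⟨x', y', a'⟩ := w
  cases a <;> cases a' <;> norm_num [aliceSign]

theorem bobSign_mul_eq_one_iff (v w : Fin m × Fin m × Bool) :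
    g.bobSign v * g.bobSign w = 1 ↔
      (-1 : ℝ) ^ (xor v.2.2 w.2.2).toNat = g.signMatrix v.1 v.2.1 * g.signMatrix w.1 w.2.1 := by
  have h : (-1 : ℝ) ^ (xor v.2.2 w.2.2).toNat = aliceSign v * aliceSign w := by
    obtain ⟨x, y, a⟩ := v
    obtain ⟨x', y', a'⟩ := w
    cases a <;> cases a' <;> norm_num [aliceSign]
  rw [h]
  unfold bobSign
  have h1 := aliceSign_sq v
  have h2 := aliceSign_sq w
  constructor
  · intro h3
    linear_combination g.signMatrix v.1 v.2.1 * g.signMatrix w.1 w.2.1 * h1 +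
      g.signMatrix v.1 v.2.1 * g.signMatrix w.1 w.2.1 * aliceSign v ^ 2 * h2 -
      aliceSign v * aliceSign w * h3
  · intro h3
    linear_combination h1 + aliceSign v ^ 2 * h2 - aliceSign v * aliceSign w * h3

theorem graph_adj_iff_sign (v w : Fin m × Fin m × Bool) :
    g.graph.Adj v w ↔ (v.1 = w.1 ∧ aliceSign v * aliceSign w ≠ 1) ∨
      (v.2.1 = w.2.1 ∧ g.bobSign v * g.bobSign w ≠ 1) := by
  rw [Ne, Ne, aliceSign_eq_iff, bobSign_mul_eq_one_iff]
  rfl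

/-- A matrix supported on the diagonal and the edges of the exclusivity graph that dominates the
all-ones matrix. -/
noncomputable def thetaMatrix (c : ℝ) :
    Matrix (Fin m × Fin m × Bool) (Fin m × Fin m × Bool) ℝ :=
  Matrix.of fun v w =>
    (m / 2 : ℝ) * ((if v.1 = w.1 then 1 - aliceSign v * aliceSign w else 0) +
      (if v.2.1 = w.2.1 then 1 - g.bobSign v * g.bobSign w else 0)) +
    if (v.1, v.2.1) = (w.1, w.2.1) then c * (aliceSign v * aliceSign w) else 0

theorem thetaMatrix_diag (c : ℝ) (v : Fin m × Fin m × Bool) : g.thetaMatrix c v v = c := by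
  simp [thetaMatrix, aliceSign_sq, bobSign_sq]

theorem thetaMatrix_eq_zero (c : ℝ) (v w : Fin m × Fin m × Bool) (hne : v ≠ w)
    (hadj : ¬ g.graph.Adj v w) : g.thetaMatrix c v w = 0 := by
  rw [graph_adj_iff_sign] at hadj
  push Not at hadj
  -- Non-adjacency makes both brackets of `thetaMatrix` vanish; two distinct events with equal
  -- questions differ in Alice's answer, hence are adjacent, so the last term vanishes too.
  obtain ⟨h1, h2⟩ := hadj
  have h3 : (v.1, v.2.1) ≠ (w.1, w.2.1) := by
    intro h
    have hx : v.1 = w.1 := (Prod.mk.inj h).1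
    have hy : v.2.1 = w.2.1 := (Prod.mk.inj h).2
    exact hne (Prod.ext hx (Prod.ext hy ((aliceSign_eq_iff v w).1 (h1 hx))))
  rw [thetaMatrix, Matrix.of_apply, if_neg h3]
  have h4 : (if v.1 = w.1 then 1 - aliceSign v * aliceSign w else 0) = 0 :=
    ite_eq_right_iff.2 fun h => by rw [h1 h, sub_self]
  have h5 : (if v.2.1 = w.2.1 then 1 - g.bobSign v * g.bobSign w else 0) = 0 :=
    ite_eq_right_iff.2 fun h => by rw [h2 h, sub_self]
  rw [h4, h5]
  simp

/-- Cauchy–Schwarz over the `m` fibres. -/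
theorem sq_sum_le_sum_fiber {V : Type*} [Fintype V] (π : V → Fin m) (F : V → ℝ) :
    (∑ v, F v) ^ 2 ≤ m * ∑ i, (∑ v, if π v = i then F v else 0) ^ 2 := by
  have h := sq_sum_le_card_mul_sum_sq (s := Finset.univ)
    (f := fun i => ∑ v, if π v = i then F v else 0)
  rw [Finset.sum_comm] at h
  simpa using h

/-- The unsigned terms, grouped by `x` and by `y`, each carry weight `m / 2` and dominate half of
`(∑ F)²`. The signed terms depend only on `o`, the difference of `F` over the two answers, and
reduce to the row and column estimate scaled by `m / 2`, which fixes `c`. -/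
theorem thetaMatrix_sub_one_posSemidef :
    (g.thetaMatrix (1 / 2 * m * (m + matrixSpectralNorm g.signMatrix)) -
      Matrix.of fun _ _ => 1).PosSemidef := by
  set σ := matrixSpectralNorm g.signMatrix
  refine Matrix.PosSemidef.of_dotProduct_mulVec_nonneg ?_ fun F => ?_
  · ext v w
    simp only [Matrix.conjTranspose_apply, Matrix.sub_apply, Matrix.of_apply, thetaMatrix,
      star_trivial, eq_comm (a := w.1), eq_comm (a := w.2.1),
      eq_comm (a := (w.1, w.2.1)), mul_comm (aliceSign w), mul_comm (g.bobSign w)]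
  · set c : ℝ := 1 / 2 * m * (m + σ)
    let o : Fin m → Fin m → ℝ := fun x y => ∑ a, aliceSign (x, y, a) * F (x, y, a)
    have hexp : dotProduct (star F) ((g.thetaMatrix c - Matrix.of fun _ _ => 1).mulVec F) =
        (m / 2 : ℝ) * (∑ v, ∑ w, (if v.1 = w.1 then F v * F w else 0)
          - ∑ v, ∑ w, (if v.1 = w.1 then (aliceSign v * F v) * (aliceSign w * F w) else 0)
          + ∑ v, ∑ w, (if v.2.1 = w.2.1 then F v * F w else 0)
          - ∑ v, ∑ w, (if v.2.1 = w.2.1 then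
              (g.bobSign v * F v) * (g.bobSign w * F w) else 0))
        + c * ∑ v, ∑ w, (if (v.1, v.2.1) = (w.1, w.2.1) then
              (aliceSign v * F v) * (aliceSign w * F w) else 0)
        - (∑ v, F v) * ∑ w, F w := by
      rw [Finset.sum_mul_sum]
      simp only [dotProduct, Matrix.mulVec, Finset.mul_sum, ← Finset.sum_sub_distrib,
        ← Finset.sum_add_distrib, Pi.star_apply, star_trivial]
      refine Finset.sum_congr rfl fun v _ => Finset.sum_congr rfl fun w _ => ?_
      simp only [Matrix.sub_apply, Matrix.of_apply, thetaMatrix]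
      split_ifs <;> ring
    rw [hexp, sum_sum_ite_fiber_eq (fun v : Fin m × Fin m × Bool => v.1) F,
      sum_sum_ite_fiber_eq (fun v : Fin m × Fin m × Bool => v.1) fun v => aliceSign v * F v,
      sum_sum_ite_fiber_eq (fun v : Fin m × Fin m × Bool => v.2.1) F,
      sum_sum_ite_fiber_eq (fun v : Fin m × Fin m × Bool => v.2.1) fun v => g.bobSign v * F v,
      sum_sum_ite_fiber_eq (fun v : Fin m × Fin m × Bool => (v.1, v.2.1))
        fun v => aliceSign v * F v]
    have h1 := sq_sum_le_sum_fiber (fun v : Fin m × Fin m × Bool => v.1) F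
    have h2 := sq_sum_le_sum_fiber (fun v : Fin m × Fin m × Bool => v.2.1) F
    have ha : ∀ x, (∑ v : Fin m × Fin m × Bool, if v.1 = x then aliceSign v * F v else 0) =
        ∑ y, o x y := by
      intro x
      simp_rw [Fintype.sum_prod_type, o]
      rw [Finset.sum_eq_single_of_mem x (Finset.mem_univ x)]
      · simp
      · intro b _ hb
        simp [hb]
    have hb : ∀ y, (∑ v : Fin m × Fin m × Bool, if v.2.1 = y then g.bobSign v * F v else 0) =
        ∑ x, g.signMatrix x y * o x y := by
      intro y
      simp_rw [Fintype.sum_prod_type, o]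
      refine Finset.sum_congr rfl fun x _ => ?_
      rw [Finset.sum_eq_single_of_mem y (Finset.mem_univ y)]
      · simp only [if_true, bobSign, Finset.mul_sum, mul_assoc]
      · intro b _ hb
        simp [hb]
    have hc : ∀ x y, (∑ v : Fin m × Fin m × Bool,
        if (v.1, v.2.1) = (x, y) then aliceSign v * F v else 0) = o x y := by
      intro x y
      simp_rw [Fintype.sum_prod_type, o]
      rw [Finset.sum_eq_single_of_mem x (Finset.mem_univ x),
        Finset.sum_eq_single_of_mem y (Finset.mem_univ y)]
      · simp
      · intro b _ hb
        simp [hb]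
      · intro b _ hb
        simp [hb]
    have hcc : ∑ i : Fin m × Fin m, (∑ v : Fin m × Fin m × Bool,
        if (v.1, v.2.1) = i then aliceSign v * F v else 0) ^ 2 = ∑ x, ∑ y, o x y ^ 2 := by
      rw [Fintype.sum_prod_type]
      simp only [hc]
    rw [hcc]
    simp only [ha, hb]
    have h3 := mul_le_mul_of_nonneg_left (g.sum_row_sq_add_sum_col_sq_le o)
      (by positivity : (0 : ℝ) ≤ m / 2)
    have h4 : c * ∑ x, ∑ y, o x y ^ 2 =
        m / 2 * ((m + σ) * ∑ x, ∑ y, o x y ^ 2) := by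
      simp only [c]; ring
    rw [h4]
    linarith

/-! ### Independent sets from deterministic strategies -/

/-- The winning events of a deterministic strategy are pairwise compatible. -/
theorem sum_strategy_le_indepNum (u v : Fin m → ℝ) (hu : ∀ x, u x = 1 ∨ u x = -1)
    (hv : ∀ y, v y = 1 ∨ v y = -1) :
    1 / 2 * ((m : ℝ) ^ 2 + ∑ x, ∑ y, u x * g.signMatrix x y * v y) ≤ g.graph.indepNum := by
  classical
  let s : Finset (Fin m × Fin m × Bool) :=
    Finset.univ.filter fun e => aliceSign e = u e.1 ∧ g.bobSign e = v e.2.1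
  have hs : g.graph.IsIndepSet s := by
    intro e he e' he' _ hadj
    simp only [s, Finset.coe_filter, Finset.mem_univ, true_and, Set.mem_ofPred_eq] at he he'
    rw [graph_adj_iff_sign] at hadj
    rcases hadj with ⟨h, h'⟩ | ⟨h, h'⟩
    · exact h' (by rw [he.1, h, ← he'.1, aliceSign_sq])
    · exact h' (by rw [he.2, h, ← he'.2, bobSign_sq])
  have hcard : (s.card : ℝ) =
      1 / 2 * ((m : ℝ) ^ 2 + ∑ x, ∑ y, u x * g.signMatrix x y * v y) := by
    -- The strategy fixes `a`, so a question pair contributes one event if it is won and none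
    -- otherwise.
    have h1 : ∀ x y, (∑ a : Bool, if aliceSign (x, y, a) = u x ∧ g.bobSign (x, y, a) = v y
        then (1 : ℝ) else 0) = 1 / 2 * (1 + u x * g.signMatrix x y * v y) := by
      intro x y
      rw [Fintype.sum_bool]
      rcases hu x with h | h <;> rcases hv y with h' | h' <;>
        rcases g.signMatrix_eq x y with h'' | h'' <;>
        norm_num [bobSign, aliceSign, h, h', h'']
    rw [Finset.card_filter]
    push_cast
    simp only [Fintype.sum_prod_type, h1, ← Finset.mul_sum, Finset.sum_add_distrib]
    simp [sq]
  rw [← hcard]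
  exact_mod_cast hs.card_le_indepNum

theorem gameMatrix_eq_smul (hunif : g.IsUniform) :
    g.gameMatrix = (1 / (m : ℝ) ^ 2) • g.signMatrix := by
  ext x y
  simp [gameMatrix, signMatrix, hunif x y, mul_comm]

/-- The factor `1/m²` cancels because the norm is homogeneous; then each row contributes `u x ^ 2 *
‖Φ̃‖ = ‖Φ̃‖`. -/
theorem sum_maxSingularPair (hunif : g.IsUniform) (u v : Fin m → ℝ)
    (hu : ∀ x, u x = 1 ∨ u x = -1) (h : IsMaxSingularPair g.gameMatrix u v) :
    ∑ x, ∑ y, u x * g.signMatrix x y * v y = m * matrixSpectralNorm g.signMatrix := by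
  rcases Nat.eq_zero_or_pos m with rfl | hm
  · simp
  have hm' : (0 : ℝ) < m := by exact_mod_cast hm
  have h1 := h.2.2.1
  rw [g.gameMatrix_eq_smul hunif, matrixSpectralNorm_smul, abs_of_pos (by positivity),
    Matrix.smul_mulVec, mul_smul] at h1
  have h2 := smul_right_injective (Fin m → ℝ) (by positivity : (1 / (m : ℝ) ^ 2) ≠ 0) h1
  have h3 : ∀ x, ∑ y, u x * g.signMatrix x y * v y = matrixSpectralNorm g.signMatrix := by
    intro x
    have h4 := congrFun h2 x
    simp only [Matrix.mulVec, dotProduct, Pi.smul_apply, smul_eq_mul] at h4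
    simp only [mul_assoc, ← Finset.mul_sum]
    rw [h4]
    rcases hu x with h | h <;> simp [h]
  simp [h3]

end XorGame

theorem mainTheorem3 {m : ℕ} (g : XorGame m) (hunif : g.IsUniform)
    (hsing : ∃ u v : Fin m → ℝ, (∀ x, u x = 1 ∨ u x = -1) ∧ (∀ y, v y = 1 ∨ v y = -1) ∧
      IsMaxSingularPair g.gameMatrix u v) :
    g.graph.shannonCapacity = (g.graph.indepNum : ℝ) ∧
      (g.graph.indepNum : ℝ) = 1 / 2 * (m : ℝ) * ((m : ℝ) + matrixSpectralNorm g.signMatrix) := by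
  obtain ⟨u, v, hu, hv, h⟩ := hsing
  have hlow := g.sum_strategy_le_indepNum u v hu hv
  rw [g.sum_maxSingularPair hunif u v hu h] at hlow
  have hσ := matrixSpectralNorm_nonneg g.signMatrix
  have hup := g.graph.shannonCapacity_le (by positivity) g.thetaMatrix_sub_one_posSemidef
    (fun v => (g.thetaMatrix_diag _ v).le) (g.thetaMatrix_eq_zero _)
  have hmid := g.graph.indepNum_le_shannonCapacity
  constructor <;> linarith
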